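/- For $n\ge 1$ and real $q$, let $\mathsf S_n^{\mathrm{pl}}(q)=\{P_G(q): G \text{ a simple planar graph on } n \text{ vertices}\}$, where $P_G$ is the chromatic polynomial of $G$. **Theorem.** For every real $q\notin\{0,1,2\}$ the number $|\mathsf S_n^{\mathrm{pl}}(q)|$ grows (at least) exponentially in $n$: there is a constant $c=c(q)>1$ such that $|\mathsf S_n^{\mathrm{pl}}(q)|\ge c^{\,n}$ for all sufficiently large $n$. Moreover, the following bounds hold. 1. If $q<0$, then $|\mathsf S_n^{\mathrm{pl}}(q)|\ge 2^{(n-2)/2}$ for all $n\ge 1$. 2. There is a function $\varepsilon(n)=o(n)$, independent of $q$, such that $|\mathsf S_n^{\mathrm{pl}}(q)|\ge 2^{n/8-\varepsilon(n)}$ for all $q\in(0,2)\setminus\{1\}$ and all $n\ge 1$. 3. If $q>2$, then $|\mathsf S_n^{\mathrm{pl}}(q)|\ge \sqrt{F_{n-2}}$ for all $n\ge 2$, where $(F_k)_{k\ge 0}$ is the Fibonacci sequence with $F_0=0$, $F_1=1$. Here $\sqrt{F_{n-2}}=\Theta\big(\varphi^{(n-2)/2}\big)$ as $n\to\infty$,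 with $\varphi=(1+\sqrt5)/2$. -/

import Mathlib

open Polynomial Filter Asymptotics

/-- The proper colourings with a prescribed partition into colour classes are the injective
labellings of the classes, when every class is independent. -/
noncomputable def coloringFiberEquiv {V : Type*} (G : SimpleGraph V) (k : ℕ) (s : Setoid V)
    (hs : ∀ u v, s u v → ¬ G.Adj u v) :
    {C : G.Coloring (Fin k) // Setoid.ker (fun v => C v) = s} ≃ (Quotient s ↪ Fin k) where
  toFun C := ⟨Quotient.lift (fun v => C.1 v) (fun u v h => by
      have h' : s u v := h
      rw [← C.2] at h'
      exact h'), by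
    rintro ⟨u⟩ ⟨v⟩ h
    refine Quotient.sound ?_
    have h' : Setoid.ker (fun v => C.1 v) u v := h
    rw [C.2] at h'
    exact h'⟩
  invFun f := ⟨SimpleGraph.Coloring.mk (fun v => f (Quotient.mk s v)) (by
      intro u v huv h
      exact hs u v (Quotient.exact (f.injective h)) huv), by
    ext u v
    constructor
    · intro h
      exact Quotient.exact (f.injective h)
    · intro h
      exact congrArg f (Quotient.sound h)⟩
  left_inv C := by
    ext v
    rfl
  right_inv f := by
    ext ⟨v⟩
    rfl

theorem exists_chromaticPolynomial {V : Type*} [Finite V] (G : SimpleGraph V) :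
    ∃ P : ℤ[X], ∀ k : ℕ, P.eval (k : ℤ) = (Nat.card (G.Coloring (Fin k)) : ℤ) := by
  classical
  have : Finite (Setoid V) := Finite.of_injective (fun s : Setoid V => fun u v => s u v)
    fun s t h => Setoid.ext fun u v => iff_of_eq (congrFun (congrFun h u) v)
  have : Fintype (Setoid V) := Fintype.ofFinite _
  refine ⟨∑ s : Setoid V, if ∀ u v, s u v → ¬ G.Adj u v then
    descPochhammer ℤ (Nat.card (Quotient s)) else 0, fun k => ?_⟩
  have hfin : Finite (G.Coloring (Fin k)) := DFunLike.finite _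
  rw [← Nat.card_congr (Equiv.sigmaFiberEquiv
    (fun C : G.Coloring (Fin k) => Setoid.ker (fun v => C v))), Nat.card_sigma,
    Polynomial.eval_finsetSum, Nat.cast_sum]
  refine Finset.sum_congr rfl fun s _ => ?_
  split_ifs with hs
  · have : Fintype (Quotient s) := Fintype.ofFinite _
    rw [Nat.card_congr (coloringFiberEquiv G k s hs), Nat.card_eq_fintype_card,
      Nat.card_eq_fintype_card, Fintype.card_embedding_eq, Fintype.card_fin,
      descPochhammer_eval_eq_descFactorial]
  · have : IsEmpty {C : G.Coloring (Fin k) // Setoid.ker (fun v => C v) = s} := by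
      refine ⟨fun C => hs fun u v huv hadj => ?_⟩
      rw [← C.2] at huv
      exact C.1.valid hadj huv
    simp

/-- The chromatic polynomial of a finite graph: the polynomial whose value at every natural
number `k` is the number of proper `k`-colourings. -/
noncomputable def chromaticPolynomial {V : Type*} [Finite V] (G : SimpleGraph V) : ℤ[X] :=
  Classical.choose (exists_chromaticPolynomial G)

theorem chromaticPolynomial_eval {V : Type*} [Finite V] (G : SimpleGraph V) (k : ℕ) :
    (chromaticPolynomial G).eval (k : ℤ) = (Nat.card (G.Coloring (Fin k)) : ℤ) :=
  Classical.choose_spec (exists_chromaticPolynomial G) k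

/-- The chromatic polynomial is the only polynomial that counts the proper `k`-colourings for
every integer `k ≥ 1`. -/
theorem chromaticPolynomial_unique {V : Type*} [Finite V] (G : SimpleGraph V) (P : ℤ[X])
    (hP : ∀ k : ℕ, 1 ≤ k → P.eval (k : ℤ) = (Nat.card (G.Coloring (Fin k)) : ℤ)) :
    P = chromaticPolynomial G := by
  refine Polynomial.eq_of_infinite_eval_eq _ _ ?_
  refine Set.Infinite.mono ?_ ((Set.Ici_infinite (1 : ℕ)).image
    (Nat.cast_injective (R := ℤ)).injOn)
  rintro _ ⟨k, hk, rfl⟩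
  exact (hP k hk).trans (chromaticPolynomial_eval G k).symm

/-- `A` is a simple (Jordan) arc in the plane with end points `x` and `y`. -/
def IsJordanArc (A : Set (EuclideanSpace ℝ (Fin 2))) (x y : EuclideanSpace ℝ (Fin 2)) : Prop :=
  ∃ γ : Path x y, Function.Injective γ ∧ Set.range γ = A

/-- A crossing-free drawing of the graph `G` in the plane: vertices are distinct points, edges are
simple arcs joining their end points, an arc passes through no vertex other than its end points,
and two different arcs meet only in common end points. The values of `arc` at pairs that are not
edges are irrelevant. -/
structure PlaneDrawing {V : Type*} (G : SimpleGraph V) where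
  pt : V → EuclideanSpace ℝ (Fin 2)
  arc : Sym2 V → Set (EuclideanSpace ℝ (Fin 2))
  pt_injective : Function.Injective pt
  isJordanArc : ∀ u v, G.Adj u v → IsJordanArc (arc s(u, v)) (pt u) (pt v)
  pt_mem_arc : ∀ e ∈ G.edgeSet, ∀ w, pt w ∈ arc e → w ∈ e
  arc_inter_arc : ∀ e ∈ G.edgeSet, ∀ f ∈ G.edgeSet, e ≠ f →
    arc e ∩ arc f ⊆ pt '' {v | v ∈ e ∧ v ∈ f}

/-- A graph is planar if it has a crossing-free drawing in the plane. -/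
def IsPlanarGraph {V : Type*} (G : SimpleGraph V) : Prop :=
  Nonempty (PlaneDrawing G)

/-- The planar evaluation spectrum: the set of the values `P_G(q)` as `G` ranges over all simple
planar graphs on `n` vertices. -/
noncomputable def planarSpectrum (n : ℕ) (q : ℝ) : Set ℝ :=
  {x | ∃ G : SimpleGraph (Fin n), IsPlanarGraph G ∧ aeval q (chromaticPolynomial G) = x}

/-! Take a graph with two terminals u, v. Let A and B be the polynomials counting the colourings in
which the terminals differ or coincide, and let s = (q-1)B/A. Two isolated vertices have s = 1.
Appending an edge at a terminal acts by the Möbius map σ(s) = (q-1)/(q-2+s). Parallel composition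
multiplies values of s, so joining the terminals by a path with one or two interior vertices
multiplies s by a = σ(0) or by c = σ(a). For each range of q there is an interval J and two
injective words in these operations that map J into disjoint parts of J. Different sequences of
words then give different s, so the number of ratios on n vertices satisfies an exponential or
Fibonacci recursion (`ManyRatios.add`). For q < 1, the words σ and a act on (0,1]. For q > 2, the
words σ² and a act on [1,∞). For 1 < q < 2, the words σ² and c² act on [1-q,0). Since A and A+B are
the chromatic polynomials of G+uv and G, each ratio with A(q) ≠ 0 is determined by a pair of
spectrum values. Hence N ratios force at least √N values (`ManyRatios.le_ncard_sq`). Planarity is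
kept as an invariant: deleting u leaves non-crossing chords of a parabola, and u sees every vertex
from below. Every operation inserts vertices next to an existing one. -/

/-! ### Planar drawings from non-crossing chords of a parabola -/

/-- The vertices other than `u` can be placed on a parabola at the abscissae `x` so that the edges
avoiding `u` become pairwise non-crossing chords. Joining further vertices to `u`, placed far below
the parabola, then keeps the drawing planar. -/
structure ConeDrawable {V : Type*} (G : SimpleGraph V) (u : V) (x : V → ℝ) : Prop where
  injective : Function.Injective x
  not_crossing : ∀ a b c d, G.Adj a b → G.Adj c d → a ≠ u → b ≠ u → c ≠ u → d ≠ u →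
    ¬ (x a < x c ∧ x c < x b ∧ x b < x d)

theorem isJordanArc_segment {p q : EuclideanSpace ℝ (Fin 2)} (h : p ≠ q) :
    IsJordanArc (segment ℝ p q) p q := by
  refine ⟨Path.segment p q, fun s t hst => ?_, Path.range_segment p q⟩
  rw [Path.segment_apply, Path.segment_apply] at hst
  exact Subtype.ext (AffineMap.lineMap_injective ℝ h hst)

theorem mem_segment_plane {p q z : EuclideanSpace ℝ (Fin 2)} (hz : z ∈ segment ℝ p q) :
    ∃ s t : ℝ, 0 ≤ s ∧ 0 ≤ t ∧ s + t = 1 ∧ z 0 = s * p 0 + t * q 0 ∧ z 1 = s * p 1 + t * q 1 := by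
  obtain ⟨s, t, hs, ht, hst, rfl⟩ := hz
  exact ⟨s, t, hs, ht, hst, by simp, by simp⟩

theorem eq_of_coord {p q : EuclideanSpace ℝ (Fin 2)} (h0 : p 0 = q 0) (h1 : p 1 = q 1) :
    p = q := by
  ext i
  fin_cases i
  · exact h0
  · exact h1

/-- The position of the vertices: `u` at `(0, -L)`, the others on the parabola. -/
noncomputable def conePoint {V : Type*} (u : V) (x : V → ℝ) (L : ℝ) (v : V) :
    EuclideanSpace ℝ (Fin 2) :=
  open Classical in if v = u then !₂[0, -L] else !₂[x v, x v ^ 2]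

noncomputable def coneArc {V : Type*} (u : V) (x : V → ℝ) (L : ℝ) (e : Sym2 V) :
    Set (EuclideanSpace ℝ (Fin 2)) :=
  Sym2.lift ⟨fun a b => segment ℝ (conePoint u x L a) (conePoint u x L b),
    fun _ _ => segment_symm ℝ _ _⟩ e

section ConeDrawing

variable {V : Type*} {G : SimpleGraph V} {u : V} {x : V → ℝ} {L : ℝ}

theorem conePoint_self_zero : conePoint u x L u 0 = 0 := by simp [conePoint]

theorem conePoint_self_one : conePoint u x L u 1 = -L := by simp [conePoint]

theorem conePoint_zero {v : V} (h : v ≠ u) : conePoint u x L v 0 = x v := by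
  simp [conePoint, h]

theorem conePoint_one {v : V} (h : v ≠ u) : conePoint u x L v 1 = x v ^ 2 := by
  simp [conePoint, h]

theorem eq_conePoint {v : V} {z : EuclideanSpace ℝ (Fin 2)} (h : v ≠ u) (h0 : z 0 = x v)
    (h1 : z 1 = z 0 ^ 2) : conePoint u x L v = z :=
  eq_of_coord (by rw [conePoint_zero h, h0]) (by rw [conePoint_one h, h1, h0])

theorem mem_spoke {a : V} (ha : a ≠ u) {z : EuclideanSpace ℝ (Fin 2)}
    (hz : z ∈ coneArc u x L s(u, a)) :
    ∃ t : ℝ, t ≤ 1 ∧ z 0 = t * x a ∧ z 1 = t * x a ^ 2 - (1 - t) * L := by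
  obtain ⟨s, t, hs, -, hst, h0, h1⟩ := mem_segment_plane hz
  rw [conePoint_self_zero, conePoint_zero ha] at h0
  rw [conePoint_self_one, conePoint_one ha] at h1
  refine ⟨t, by linarith, by linarith, ?_⟩
  rw [h1, ← hst]
  ring

/-- The product is the height of the chord above the parabola, so comparing two chords over one
abscissa means comparing two such products. -/
theorem mem_chord {a b : V} (ha : a ≠ u) (hb : b ≠ u) (hab : x a < x b)
    {z : EuclideanSpace ℝ (Fin 2)} (hz : z ∈ coneArc u x L s(a, b)) :
    x a ≤ z 0 ∧ z 0 ≤ x b ∧ z 1 = z 0 ^ 2 + (z 0 - x a) * (x b - z 0) := by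
  obtain ⟨s, t, hs, ht, hst, h0, h1⟩ := mem_segment_plane hz
  rw [conePoint_zero ha, conePoint_zero hb] at h0
  rw [conePoint_one ha, conePoint_one hb] at h1
  obtain rfl : s = 1 - t := by linarith
  refine ⟨by rw [h0]; nlinarith, by rw [h0]; nlinarith, by rw [h1, h0]; ring⟩

theorem edge_cases (hx : Function.Injective x) {e : Sym2 V} (he : e ∈ G.edgeSet) :
    (∃ a, a ≠ u ∧ e = s(u, a)) ∨
      ∃ a b, a ≠ u ∧ b ≠ u ∧ x a < x b ∧ G.Adj a b ∧ e = s(a, b) := by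
  induction e using Sym2.ind with
  | _ a b =>
    have hab : G.Adj a b := he
    by_cases ha : a = u
    · exact Or.inl ⟨b, fun h => hab.ne (ha.trans h.symm), by rw [ha]⟩
    by_cases hb : b = u
    · exact Or.inl ⟨a, ha, by rw [hb, Sym2.eq_swap]⟩
    rcases lt_or_gt_of_ne (fun h => hab.ne (hx h)) with h | h
    · exact Or.inr ⟨a, b, ha, hb, h, hab, rfl⟩
    · exact Or.inr ⟨b, a, hb, ha, h, hab.symm, Sym2.eq_swap⟩

/-- Points of a spoke lie below the parabola, except for its end point. -/
theorem spoke_below {a : V} (hL : x a ^ 2 < L) {t z₀ z₁ : ℝ} (ht : t ≤ 1)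
    (h0 : z₀ = t * x a) (h1 : z₁ = t * x a ^ 2 - (1 - t) * L) (h : z₀ ^ 2 ≤ z₁) : t = 1 := by
  by_contra hne
  have hlt : 0 < 1 - t := by
    rcases ht.lt_or_eq with h | h
    · linarith
    · exact absurd h hne
  have key : 0 < (1 - t) * (L - t * x a ^ 2) :=
    mul_pos hlt (by nlinarith [sq_nonneg (x a)])
  rw [h0, h1] at h
  nlinarith

/-- A line through the apex meets the parabola at two abscissae with product `L`. As both squares
are below `L`, two different vertices are never collinear with the apex. -/
theorem spoke_inter_spoke {a b : V} (ha : x a ^ 2 < L) (hb : x b ^ 2 < L) (hab : x a ≠ x b)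
    {s t : ℝ} (h0 : s * x a = t * x b)
    (h1 : s * x a ^ 2 - (1 - s) * L = t * x b ^ 2 - (1 - t) * L) : s = 0 := by
  have hL : 0 < L := lt_of_le_of_lt (sq_nonneg _) ha
  have h2 : s * (x a ^ 2 + L) = t * (x b ^ 2 + L) := by linarith
  have h3 : (s * t) * ((x a - x b) * (L - x a * x b)) = 0 := by
    linear_combination (t * (x b ^ 2 + L)) * h0 - t * x b * h2
  have h4 : 0 < L - x a * x b := by nlinarith [sq_nonneg (x a - x b)]
  have h5 : s * t = 0 := by
    rcases mul_eq_zero.mp h3 with h | h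
    · exact h
    · exact absurd h (mul_ne_zero (sub_ne_zero.mpr hab) h4.ne')
  rcases mul_eq_zero.mp h5 with h | h
  · exact h
  · rw [h, zero_mul] at h2
    exact (mul_eq_zero.mp h2).resolve_right (by positivity)

/-- Chords lie on or above the parabola and spokes on or below it, so they can only meet at a vertex
on the parabola. -/
theorem chord_inter_spoke {a b c : V} (hL : ∀ v, x v ^ 2 < L) (ha : a ≠ u) (hb : b ≠ u)
    (hc : c ≠ u) (hx : Function.Injective x) (hab : x a < x b)
    {z : EuclideanSpace ℝ (Fin 2)} (hz : z ∈ coneArc u x L s(a, b))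
    (hz' : z ∈ coneArc u x L s(u, c)) : (c = a ∨ c = b) ∧ conePoint u x L c = z := by
  obtain ⟨h1, h2, h3⟩ := mem_chord ha hb hab hz
  obtain ⟨t, ht, h4, h5⟩ := mem_spoke hc hz'
  obtain rfl := spoke_below (hL c) ht h4 h5
    (by rw [h3]; nlinarith [mul_nonneg (sub_nonneg.mpr h1) (sub_nonneg.mpr h2)])
  have h6 : z 0 = x c := by linarith
  have h7 : (z 0 - x a) * (x b - z 0) = 0 := by
    rw [h6] at h3 ⊢
    linarith
  refine ⟨?_, eq_conePoint hc h6 (by rw [h3, h7, add_zero])⟩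
  rcases mul_eq_zero.mp h7 with h | h
  · exact Or.inl (hx (by linarith))
  · exact Or.inr (hx (by linarith))

/-- The intersection of two distinct non-crossing chords, the first one starting first. -/
theorem chord_inter_chord {a b c d z : ℝ} (hac : a ≤ c) (hne : ¬ (a = c ∧ b = d))
    (hcr : ¬ (a < c ∧ c < b ∧ b < d)) (h1 : a ≤ z) (h2 : z ≤ b) (h3 : c ≤ z) (h4 : z ≤ d)
    (h : (z - a) * (b - z) = (z - c) * (d - z)) :
    (z = a ∧ z = c) ∨ (z = a ∧ z = d) ∨ (z = b ∧ z = c) ∨ (z = b ∧ z = d) := by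
  rcases h1.eq_or_lt with e1 | l1
  · exact Or.inl ⟨e1.symm, by linarith⟩
  rcases h2.eq_or_lt with e2 | l2
  · subst e2
    have : (z - c) * (d - z) = 0 := by linarith
    rcases mul_eq_zero.mp this with h | h
    · exact Or.inr (Or.inr (Or.inl ⟨rfl, by linarith⟩))
    · exact Or.inr (Or.inr (Or.inr ⟨rfl, by linarith⟩))
  have hpos : 0 < (z - a) * (b - z) := mul_pos (by linarith) (by linarith)
  have l3 : c < z := lt_of_le_of_ne h3 (by rintro rfl; rw [sub_self, zero_mul] at h; linarith)
  rcases hac.eq_or_lt with e | l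
  · subst e
    have : b - z = d - z := mul_left_cancel₀ (by linarith) h
    exact absurd ⟨rfl, by linarith⟩ hne
  -- The second chord is now nested under the first and starts strictly later, so it is strictly
  -- lower at an interior abscissa of the first.
  · have hdb : d ≤ b := not_lt.mp fun hbd => hcr ⟨l, by linarith, hbd⟩
    nlinarith [mul_pos (sub_pos.mpr l) (sub_pos.mpr l2),
      mul_nonneg (sub_nonneg.mpr h3) (sub_nonneg.mpr hdb)]

theorem ConeDrawable.chord_inter (h : ConeDrawable G u x) {a b c d : V} (ha : a ≠ u)
    (hb : b ≠ u) (hc : c ≠ u) (hd : d ≠ u) (hab : x a < x b) (hcd : x c < x d)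
    (hG : G.Adj a b) (hG' : G.Adj c d) (hne : s(a, b) ≠ s(c, d)) (hac : x a ≤ x c)
    {z : EuclideanSpace ℝ (Fin 2)} (hz : z ∈ coneArc u x L s(a, b))
    (hz' : z ∈ coneArc u x L s(c, d)) :
    ∃ v, (v ∈ s(a, b) ∧ v ∈ s(c, d)) ∧ conePoint u x L v = z := by
  obtain ⟨h1, h2, h3⟩ := mem_chord ha hb hab hz
  obtain ⟨h4, h5, h6⟩ := mem_chord hc hd hcd hz'
  have hxne : ¬ (x a = x c ∧ x b = x d) := fun hh =>
    hne (by rw [h.injective hh.1, h.injective hh.2])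
  rcases chord_inter_chord hac hxne (h.not_crossing a b c d hG hG' ha hb hc hd) h1 h2 h4 h5
    (by linarith) with ⟨e1, e2⟩ | ⟨e1, e2⟩ | ⟨e1, e2⟩ | ⟨e1, e2⟩
  · exact ⟨a, ⟨by simp, by simp [h.injective (e1.symm.trans e2)]⟩,
      eq_conePoint ha e1 (by rw [h3, e1]; ring)⟩
  · exact ⟨a, ⟨by simp, by simp [h.injective (e1.symm.trans e2)]⟩,
      eq_conePoint ha e1 (by rw [h3, e1]; ring)⟩
  · exact ⟨b, ⟨by simp, by simp [h.injective (e1.symm.trans e2)]⟩,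
      eq_conePoint hb e1 (by rw [h3, e1]; ring)⟩
  · exact ⟨b, ⟨by simp, by simp [h.injective (e1.symm.trans e2)]⟩,
      eq_conePoint hb e1 (by rw [h3, e1]; ring)⟩

theorem conePoint_injective (hx : Function.Injective x) (hL : 0 < L) :
    Function.Injective (conePoint u x L) := by
  intro a b hab
  have h0 := congrArg (fun p : EuclideanSpace ℝ (Fin 2) => p 0) hab
  have h1 := congrArg (fun p : EuclideanSpace ℝ (Fin 2) => p 1) hab
  simp only at h0 h1
  by_cases ha : a = u <;> by_cases hb : b = u
  · rw [ha, hb]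
  · rw [ha, conePoint_self_one, conePoint_one hb] at h1
    nlinarith [sq_nonneg (x b)]
  · rw [hb, conePoint_self_one, conePoint_one ha] at h1
    nlinarith [sq_nonneg (x a)]
  · rw [conePoint_zero ha, conePoint_zero hb] at h0
    exact hx h0

theorem conePoint_mem_coneArc (hx : Function.Injective x) (hL : ∀ v, x v ^ 2 < L) {e : Sym2 V}
    (he : e ∈ G.edgeSet) {w : V} (hw : conePoint u x L w ∈ coneArc u x L e) : w ∈ e := by
  have hL0 : 0 < L := lt_of_le_of_lt (sq_nonneg _) (hL u)
  rcases edge_cases (u := u) hx he with ⟨a, ha, rfl⟩ | ⟨a, b, ha, hb, hab, -, rfl⟩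
  · by_cases hwu : w = u
    · simp [hwu]
    · obtain ⟨t, ht, h0, h1⟩ := mem_spoke ha hw
      rw [conePoint_zero hwu] at h0
      rw [conePoint_one hwu] at h1
      obtain rfl := spoke_below (hL a) ht h0 h1 le_rfl
      rw [one_mul] at h0
      simp [hx h0]
  · obtain ⟨h1, h2, h3⟩ := mem_chord ha hb hab hw
    by_cases hwu : w = u
    · subst hwu
      rw [conePoint_self_one] at h3
      nlinarith [mul_nonneg (sub_nonneg.mpr h1) (sub_nonneg.mpr h2),
        sq_nonneg (conePoint w x L w 0)]
    · rw [conePoint_zero hwu, conePoint_one hwu] at h3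
      have h4 : (x w - x a) * (x b - x w) = 0 := by linarith
      rcases mul_eq_zero.mp h4 with h | h
      · simp [hx (show x w = x a by linarith)]
      · simp [hx (show x w = x b by linarith)]

theorem ConeDrawable.arc_inter_arc (h : ConeDrawable G u x) (hL : ∀ v, x v ^ 2 < L)
    {e f : Sym2 V} (he : e ∈ G.edgeSet) (hf : f ∈ G.edgeSet) (hef : e ≠ f) :
    coneArc u x L e ∩ coneArc u x L f ⊆ conePoint u x L '' {v | v ∈ e ∧ v ∈ f} := by
  rintro z ⟨hze, hzf⟩
  rcases edge_cases (u := u) h.injective he with ⟨a, ha, rfl⟩ | ⟨a, b, ha, hb, hab, hG, rfl⟩ <;>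
  rcases edge_cases (u := u) h.injective hf with ⟨c, hc, rfl⟩ | ⟨c, d, hc, hd, hcd, hG', rfl⟩
  · obtain ⟨s, -, h0, h1⟩ := mem_spoke ha hze
    obtain ⟨t, -, h0', h1'⟩ := mem_spoke hc hzf
    have hac : x a ≠ x c := fun hh => hef (by rw [h.injective hh])
    have hs0 := spoke_inter_spoke (hL a) (hL c) hac (h0.symm.trans h0')
      (h1.symm.trans h1')
    rw [hs0] at h0 h1
    refine ⟨u, by simp, eq_of_coord ?_ ?_⟩
    · rw [conePoint_self_zero, h0, zero_mul]
    · rw [conePoint_self_one, h1]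
      ring
  · obtain ⟨h1, h2⟩ := chord_inter_spoke hL hc hd ha h.injective hcd hzf hze
    exact ⟨a, ⟨by simp, by simpa using h1⟩, h2⟩
  · obtain ⟨h1, h2⟩ := chord_inter_spoke hL ha hb hc h.injective hab hze hzf
    exact ⟨c, ⟨by simpa using h1, by simp⟩, h2⟩
  · rcases le_total (x a) (x c) with hac | hac
    · exact h.chord_inter ha hb hc hd hab hcd hG hG' hef hac hze hzf
    · obtain ⟨v, hv, hvz⟩ := h.chord_inter hc hd ha hb hcd hab hG' hG hef.symm hac hzf hze
      exact ⟨v, hv.symm, hvz⟩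

theorem ConeDrawable.isPlanarGraph [Finite V] (h : ConeDrawable G u x) : IsPlanarGraph G := by
  have := Fintype.ofFinite V
  obtain ⟨L, hL⟩ : ∃ L : ℝ, ∀ v, x v ^ 2 < L :=
    ⟨1 + ∑ v, x v ^ 2, fun v => by
      have := Finset.single_le_sum (fun w _ => sq_nonneg (x w)) (Finset.mem_univ v)
      linarith⟩
  have hL0 : 0 < L := lt_of_le_of_lt (sq_nonneg _) (hL u)
  exact ⟨{
    pt := conePoint u x L
    arc := coneArc u x L
    pt_injective := conePoint_injective h.injective hL0
    isJordanArc := fun a b hab =>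
      isJordanArc_segment ((conePoint_injective h.injective hL0).ne hab.ne)
    pt_mem_arc := fun e he w hw => conePoint_mem_coneArc h.injective hL he hw
    arc_inter_arc := fun e he f hf hef => h.arc_inter_arc hL he hf hef }⟩

end ConeDrawing

/-! ### Extending a drawable graph -/

/-- The graph obtained from `G` by adding a vertex `none` with neighbourhood `N`. -/
def addVertex {V : Type*} (G : SimpleGraph V) (N : Set V) : SimpleGraph (Option V) where
  Adj
    | some a, some b => G.Adj a b
    | some a, none => a ∈ N
    | none, some b => b ∈ N
    | none, none => False
  symm := ⟨by
    rintro (_ | a) (_ | b) h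
    · exact h
    · exact h
    · exact h
    · exact SimpleGraph.Adj.symm (G := G) h⟩
  loopless := ⟨by
    rintro (_ | a) h
    · exact h
    · exact G.loopless.irrefl a h⟩

/-- The abscissae of the extended graph, when the new vertex is placed at `y`. -/
def extendPlacement {V : Type*} (x : V → ℝ) (y : ℝ) : Option V → ℝ
  | none => y
  | some v => x v

theorem exists_right_neighbour {V : Type*} [Finite V] (x : V → ℝ) (p : V) :
    ∃ y, x p < y ∧ ∀ v, x p < x v → y < x v := by
  have h : ∀ᶠ y in nhdsWithin (x p) (Set.Ioi (x p)), ∀ v, x p < x v → y < x v := by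
    rw [eventually_all]
    intro v
    by_cases hv : x p < x v
    · exact (eventually_nhdsWithin_of_eventually_nhds (eventually_lt_nhds hv)).mono
        fun y hy _ => hy
    · exact Eventually.of_forall fun y h => absurd h hv
  obtain ⟨y, h1, h2⟩ := (h.and self_mem_nhdsWithin).exists
  exact ⟨y, h2, h1⟩

/-- Place the new vertex immediately to the right of `p`. No abscissa lies strictly between them, so
their chord crosses nothing, and an edge to `u` is a spoke, on which there is no constraint. -/
theorem ConeDrawable.addVertex {V : Type*} [Finite V] {G : SimpleGraph V} {u : V} {x : V → ℝ}
    (h : ConeDrawable G u x) (p : V) {N : Set V} (hN : N ⊆ {u, p}) :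
    ∃ x', ConeDrawable (addVertex G N) (some u) x' := by
  obtain ⟨y, hy, hy'⟩ := exists_right_neighbour x p
  have hne : ∀ v, x v ≠ y := fun v hv => by
    have := hy' v (hv ▸ hy)
    linarith
  have hp : ∀ a, a ∈ N → some a ≠ some u → a = p := fun a ha hau =>
    (hN ha).resolve_left fun h => hau (congrArg some h)
  refine ⟨extendPlacement x y, ?_, ?_⟩
  · rintro (_ | a) (_ | b) hab
    · rfl
    · exact absurd hab.symm (hne b)
    · exact absurd hab (hne a)
    · exact congrArg some (h.injective hab)
  · rintro (_ | a) (_ | b) (_ | c) (_ | d) hab hcd ha hb hc hd ⟨h1, h2, h3⟩ <;>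
      simp only [extendPlacement] at h1 h2 h3
    · exact hab
    · exact hab
    · exact hab
    · exact hab
    · exact hcd
    · obtain rfl := hp b hab hb
      linarith
    · obtain rfl := hp b hab hb
      linarith
    · obtain rfl := hp b hab hb
      linarith
    · exact hcd
    · linarith
    · linarith
    · obtain rfl := hp a hab ha
      linarith [hy' c h1]
    · exact hcd
    · obtain rfl := hp d hcd hd
      linarith
    · obtain rfl := hp c hcd hc
      linarith [hy' b h2]
    · exact h.not_crossing a b c d hab hcd (fun e => ha (congrArg some e))
        (fun e => hb (congrArg some e)) (fun e => hc (congrArg some e))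
        (fun e => hd (congrArg some e)) ⟨h1, h2, h3⟩

theorem ConeDrawable.sup_edge {V : Type*} {G : SimpleGraph V} {u : V} {x : V → ℝ}
    (h : ConeDrawable G u x) (v : V) : ConeDrawable (G ⊔ SimpleGraph.edge u v) u x := by
  have key : ∀ a b, (G ⊔ SimpleGraph.edge u v).Adj a b → a ≠ u → b ≠ u → G.Adj a b := by
    intro a b hab ha hb
    rw [SimpleGraph.sup_adj, SimpleGraph.edge_adj] at hab
    tauto
  exact ⟨h.injective, fun a b c d hab hcd ha hb hc hd =>
    h.not_crossing a b c d (key a b hab ha hb) (key c d hcd hc hd) ha hb hc hd⟩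

theorem ConeDrawable.comap {V W : Type*} {G : SimpleGraph V} {u : V} {x : V → ℝ}
    (h : ConeDrawable G u x) (e : W ≃ V) :
    ConeDrawable (G.comap e) (e.symm u) (x ∘ e) := by
  have key : ∀ a, a ≠ e.symm u → e a ≠ u := fun a ha h' => ha (by rw [← h', e.symm_apply_apply])
  exact ⟨h.injective.comp e.injective, fun a b c d hab hcd ha hb hc hd =>
    h.not_crossing _ _ _ _ hab hcd (key a ha) (key b hb) (key c hc) (key d hd)⟩

/-! ### Weighted sums over proper colourings -/

def IsProper {V : Type*} (G : SimpleGraph V) {k : ℕ} (C : V → Fin k) : Prop :=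
  ∀ a b, G.Adj a b → C a ≠ C b

open Classical in
/-- The sum of a weight over the proper `k`-colourings of a graph. -/
noncomputable def coloringSum {V : Type*} [Fintype V] (G : SimpleGraph V) (k : ℕ)
    (F : (V → Fin k) → ℤ) : ℤ :=
  ∑ C : V → Fin k, if IsProper G C then F C else 0

open Classical in
theorem coloringSum_eq {V : Type*} [Fintype V] [DecidableEq V] (G : SimpleGraph V) (k : ℕ)
    (F : (V → Fin k) → ℤ) :
    coloringSum G k F = ∑ C : V → Fin k, if IsProper G C then F C else 0 := by
  unfold coloringSum
  congr!

theorem isProper_sup_edge {V : Type*} (G : SimpleGraph V) {k : ℕ} {u v : V} (huv : u ≠ v)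
    (C : V → Fin k) :
    IsProper (G ⊔ SimpleGraph.edge u v) C ↔ IsProper G C ∧ C u ≠ C v := by
  simp only [IsProper, SimpleGraph.sup_adj, SimpleGraph.edge_adj]
  refine ⟨fun h => ⟨fun a b hab => h a b (Or.inl hab), h u v (by tauto)⟩, ?_⟩
  rintro ⟨h1, h2⟩ a b (hab | ⟨⟨rfl, rfl⟩ | ⟨rfl, rfl⟩, -⟩)
  · exact h1 a b hab
  · exact h2
  · exact h2.symm

/-- The indicator of equality of two colours. -/
def agree {k : ℕ} (a b : Fin k) : ℤ := if a = b then 1 else 0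

section ColoringSum

variable {V : Type*} [Fintype V] (G : SimpleGraph V) (k : ℕ)

theorem coloringSum_add (F F' : (V → Fin k) → ℤ) :
    coloringSum G k (fun C => F C + F' C) = coloringSum G k F + coloringSum G k F' := by
  simp only [coloringSum]
  rw [← Finset.sum_add_distrib]
  refine Finset.sum_congr rfl fun C _ => ?_
  split_ifs <;> simp

theorem coloringSum_mul (c : ℤ) (F : (V → Fin k) → ℤ) :
    coloringSum G k (fun C => c * F C) = c * coloringSum G k F := by
  simp only [coloringSum]
  rw [Finset.mul_sum]
  refine Finset.sum_congr rfl fun C _ => ?_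
  split_ifs <;> simp

theorem natCard_coloring : (Nat.card (G.Coloring (Fin k)) : ℤ) = coloringSum G k fun _ => 1 := by
  classical
  let e : G.Coloring (Fin k) ≃ {C : V → Fin k // IsProper G C} :=
    { toFun := fun C => ⟨fun v => C v, fun a b h => C.valid h⟩
      invFun := fun C => SimpleGraph.Coloring.mk C.1 (fun {a b} h => C.2 a b h)
      left_inv := fun C => by ext; rfl
      right_inv := fun C => rfl }
  rw [Nat.card_congr e, Nat.card_eq_fintype_card, Fintype.card_subtype, coloringSum_eq,
    Finset.sum_boole]

/-- Colour the old vertices first, then the new one. The predicate `p` allows any convenient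
decidable form of the constraint at the new vertex. -/
theorem coloringSum_addVertex {N : Set V} (p : (V → Fin k) → Fin k → Prop)
    [∀ C c, Decidable (p C c)] (hp : ∀ C c, p C c ↔ ∀ a ∈ N, c ≠ C a)
    (F : (Option V → Fin k) → ℤ) :
    coloringSum (addVertex G N) k F = coloringSum G k fun C =>
      ∑ c : Fin k, if p C c then F (fun v => v.elim c C) else 0 := by
  classical
  rw [coloringSum_eq, coloringSum_eq,
    ← (Equiv.piOptionEquivProd (β := fun _ : Option V => Fin k)).symm.sum_comp,
    Fintype.sum_prod_type, Finset.sum_comm]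
  refine Finset.sum_congr rfl fun C _ => ?_
  have hC : ∀ c : Fin k, (Equiv.piOptionEquivProd (β := fun _ : Option V => Fin k)).symm (c, C) =
      fun v => v.elim c C := fun c => by
    funext v
    cases v <;> rfl
  simp only [hC]
  split_ifs with h
  · refine Finset.sum_congr rfl fun c _ => ?_
    refine if_congr (Iff.trans ⟨fun h' a ha => h' none (some a) ha, ?_⟩ (hp C c).symm) rfl rfl
    rintro h' (_ | a) (_ | b) hab
    · exact hab.elim
    · exact h' b hab
    · exact (h' a hab).symm
    · exact h a b hab
  · exact Finset.sum_eq_zero fun c _ => if_neg fun h' => h fun a b hab =>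
      h' (some a) (some b) hab

theorem coloringSum_sup_edge {u v : V} (huv : u ≠ v) :
    coloringSum (G ⊔ SimpleGraph.edge u v) k (fun _ => 1) =
      coloringSum G k fun C => 1 - agree (C u) (C v) := by
  classical
  refine Finset.sum_congr rfl fun C _ => ?_
  simp only [isProper_sup_edge G huv C]
  by_cases h1 : IsProper G C <;> by_cases h2 : C u = C v <;> simp [h1, h2, agree]

theorem coloringSum_comap {W : Type*} [Fintype W] (e : W ≃ V) :
    coloringSum (G.comap e) k (fun _ => 1) = coloringSum G k fun _ => 1 := by
  classical
  rw [coloringSum_eq, coloringSum_eq, ← (Equiv.arrowCongr e (Equiv.refl (Fin k))).symm.sum_comp]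
  refine Finset.sum_congr rfl fun C _ => if_congr ?_ rfl rfl
  refine ⟨fun h a b hab => ?_, fun h a b hab => h _ _ hab⟩
  have := h (e.symm a) (e.symm b) (by simpa using hab)
  simpa using this

end ColoringSum

theorem ConeDrawable.mem_planarSpectrum {V : Type*} [Fintype V] {G : SimpleGraph V} {u : V}
    {x : V → ℝ} (h : ConeDrawable G u x) {P : ℤ[X]}
    (hP : ∀ k : ℕ, P.eval (k : ℤ) = coloringSum G k fun _ => 1) (q : ℝ) :
    aeval q P ∈ planarSpectrum (Fintype.card V) q := by
  have e := (Fintype.equivFin V).symm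
  refine ⟨G.comap e, (h.comap e).isPlanarGraph, ?_⟩
  rw [← chromaticPolynomial_unique (G.comap e) P fun k _ => ?_]
  rw [natCard_coloring, coloringSum_comap, hP]

section ColourCount

variable {k : ℕ} (α β : Fin k)

theorem sum_ite_ne_one : ∑ c : Fin k, (if c ≠ α then 1 else 0 : ℤ) = k - 1 := by
  have h : ∀ c : Fin k, (if c ≠ α then 1 else 0 : ℤ) = 1 - if c = α then 1 else 0 := fun c => by
    by_cases h : c = α <;> simp [h]
  simp [h]

/-- Inclusion–exclusion: `agree` gives back the colour subtracted twice when `α = β`. -/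
theorem sum_ite_ne_ne_one : ∑ c : Fin k, (if c ≠ α ∧ c ≠ β then 1 else 0 : ℤ) =
    k - 2 + agree α β := by
  simp only [agree]
  have h : ∀ c : Fin k, (if c ≠ α ∧ c ≠ β then 1 else 0 : ℤ) =
      1 - (if c = α then 1 else 0) - (if c = β then 1 else 0) +
        if c = α then (if α = β then 1 else 0) else 0 := fun c => by
    by_cases h : c = α <;> by_cases h' : c = β <;> by_cases h'' : α = β <;> simp_all
  simp only [h, Finset.sum_add_distrib, Finset.sum_sub_distrib]
  simp
  ring

end ColourCount

/-! ### Two-terminal states and operations on them -/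

/-- Some cone-drawable graph on `n` vertices, with apex `u` and a second terminal `v`, has `A`
counting its colourings separating `u` and `v` and `B` counting those identifying them. -/
def HasState (n : ℕ) (A B : ℤ[X]) : Prop :=
  ∃ (V : Type) (_ : Fintype V) (G : SimpleGraph V) (u v : V) (x : V → ℝ),
    Fintype.card V = n ∧ u ≠ v ∧ ConeDrawable G u x ∧
    (∀ k : ℕ, A.eval (k : ℤ) = coloringSum G k fun C => 1 - agree (C u) (C v)) ∧
    ∀ k : ℕ, B.eval (k : ℤ) = coloringSum G k fun C => agree (C u) (C v)

theorem coneDrawable_bot {V : Type*} (u : V) {x : V → ℝ} (hx : Function.Injective x) :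
    ConeDrawable (⊥ : SimpleGraph V) u x :=
  ⟨hx, fun _ _ _ _ h => absurd h (by simp)⟩

theorem hasState_two : HasState 2 (X * (X - 1)) X := by
  refine ⟨Fin 2, inferInstance, ⊥, 0, 1, fun i => (i : ℕ), by simp, by simp,
    coneDrawable_bot 0 (fun a b h => Fin.ext (by exact_mod_cast h)), fun k => ?_,
    fun k => ?_⟩ <;>
    rw [coloringSum_eq, ← (finTwoArrowEquiv (Fin k)).symm.sum_comp, Fintype.sum_prod_type]
  · have h : ∀ a : Fin k, ∑ b : Fin k, (1 - agree a b) = k - 1 := fun a => by simp [agree]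
    simp [IsProper, h, mul_sub]
  · simp [IsProper, agree]

/-- The colourings separating the terminals are exactly the proper colourings of the graph with the
edge `uv` added; that edge is a spoke. -/
theorem HasState.separated_mem {n : ℕ} {A B : ℤ[X]} (h : HasState n A B) (q : ℝ) :
    aeval q A ∈ planarSpectrum n q := by
  obtain ⟨V, _, G, u, v, x, rfl, huv, hG, hA, -⟩ := h
  refine (hG.sup_edge v).mem_planarSpectrum (fun k => ?_) q
  rw [coloringSum_sup_edge G k huv, hA]

theorem HasState.total_mem {n : ℕ} {A B : ℤ[X]} (h : HasState n A B) (q : ℝ) :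
    aeval q A + aeval q B ∈ planarSpectrum n q := by
  obtain ⟨V, _, G, u, v, x, rfl, huv, hG, hA, hB⟩ := h
  rw [← map_add]
  refine hG.mem_planarSpectrum (fun k => ?_) q
  rw [eval_add, hA, hB, ← coloringSum_add]
  simp

theorem HasState.isolated {n : ℕ} {A B : ℤ[X]} (h : HasState n A B) :
    HasState (n + 1) (X * A) (X * B) := by
  obtain ⟨V, _, G, u, v, x, rfl, huv, hG, hA, hB⟩ := h
  obtain ⟨x', hx'⟩ := hG.addVertex v (Set.empty_subset _)
  refine ⟨Option V, inferInstance, addVertex G ∅, some u, some v, x', by simp, by simpa, hx',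
    fun k => ?_, fun k => ?_⟩ <;>
    refine Eq.trans ?_ (coloringSum_addVertex G k (fun _ _ => True) (by simp) _).symm
  · rw [eval_mul, hA, ← coloringSum_mul]
    simp [mul_sub]
  · rw [eval_mul, hB, ← coloringSum_mul]
    simp

/-- Adding a vertex joined to both terminals. -/
theorem HasState.parallel {n : ℕ} {A B : ℤ[X]} (h : HasState n A B) :
    HasState (n + 1) ((X - 2) * A) ((X - 1) * B) := by
  obtain ⟨V, _, G, u, v, x, rfl, huv, hG, hA, hB⟩ := h
  obtain ⟨x', hx'⟩ := hG.addVertex v (Set.Subset.refl _)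
  have key : ∀ (k : ℕ) (C : V → Fin k) (f : ℤ), (∑ c : Fin k, if c ≠ C u ∧ c ≠ C v then
      f else 0) = (k - 2 + agree (C u) (C v)) * f := fun k C f => by
    rw [← sum_ite_ne_ne_one, Finset.sum_mul]
    simp only [ite_mul, one_mul, zero_mul]
  refine ⟨Option V, inferInstance, addVertex G {u, v}, some u, some v, x', by simp, by simpa, hx',
    fun k => ?_, fun k => ?_⟩ <;>
    refine Eq.trans ?_ (coloringSum_addVertex G k (fun C c => c ≠ C u ∧ c ≠ C v) (by simp) _).symm
  · rw [eval_mul, hA, ← coloringSum_mul]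
    congr 1
    funext C
    refine Eq.trans ?_ (key k C (1 - agree (C u) (C v))).symm
    by_cases h : C u = C v <;> simp [h, agree]
  · rw [eval_mul, hB, ← coloringSum_mul]
    congr 1
    funext C
    refine Eq.trans ?_ (key k C (agree (C u) (C v))).symm
    by_cases h : C u = C v <;> simp [h, agree]
    ring

/-- Adding a vertex joined to the second terminal, which it replaces. -/
theorem HasState.series {n : ℕ} {A B : ℤ[X]} (h : HasState n A B) :
    HasState (n + 1) ((X - 2) * A + (X - 1) * B) A := by
  obtain ⟨V, _, G, u, v, x, rfl, huv, hG, hA, hB⟩ := h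
  obtain ⟨x', hx'⟩ := hG.addVertex v (N := {v}) (by simp)
  -- The new terminal agrees with `u` for one colour only, which is allowed exactly when `u` and the
  -- old terminal differ. Hence the new `B` is the old `A`.
  have key : ∀ (k : ℕ) (C : V → Fin k), (∑ c : Fin k, if c ≠ C v then agree (C u) c else 0) =
      1 - agree (C u) (C v) := fun k C => by
    have h : ∀ c, (if c ≠ C v then agree (C u) c else 0) =
        if C u = c then 1 - agree (C u) (C v) else 0 := fun c => by
      by_cases h : c = C v <;> by_cases h' : C u = c <;> simp_all [agree]
    simp only [h]
    simp
  refine ⟨Option V, inferInstance, addVertex G {v}, some u, none, x', by simp, by simp, hx',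
    fun k => ?_, fun k => ?_⟩ <;>
    refine Eq.trans ?_ (coloringSum_addVertex G k (fun C c => c ≠ C v) (by simp) _).symm
  · rw [eval_add, eval_mul, eval_mul, hA, hB, ← coloringSum_mul, ← coloringSum_mul,
      ← coloringSum_add]
    congr 1
    funext C
    have h : ∀ c, (if c ≠ C v then 1 - agree (C u) c else 0) =
        (if c ≠ C v then 1 else 0) - if c ≠ C v then agree (C u) c else 0 := fun c => by
      split_ifs <;> ring
    refine Eq.trans ?_ (Finset.sum_congr rfl fun c _ => (h c).symm)
    rw [Finset.sum_sub_distrib, key, sum_ite_ne_one]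
    simp
    ring
  · rw [hA]
    congr 1
    funext C
    exact (key k C).symm

/-- Joining the terminals by a path with two interior vertices. -/
theorem HasState.parallel_path {n : ℕ} {A B : ℤ[X]} (h : HasState n A B) :
    HasState (n + 2) ((X ^ 2 - 3 * X + 3) * A) ((X - 1) * (X - 2) * B) := by
  obtain ⟨V, _, G, u, v, x, rfl, huv, hG, hA, hB⟩ := h
  obtain ⟨x', hx'⟩ := hG.addVertex v (N := {v}) (by simp)
  obtain ⟨x'', hx''⟩ := hx'.addVertex none (Set.Subset.refl _)
  -- The interior of the path has (k-1)(k-2) colourings if the end colours agree, and one more if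
  -- they differ, which is k² - 3k + 3.
  have key : ∀ (k : ℕ) (C : V → Fin k) (f : ℤ),
      (∑ c : Fin k, if c ≠ C v then ∑ d : Fin k, (if d ≠ C u ∧ d ≠ c then f else 0) else 0) =
        ((k - 1) * (k - 2) + (1 - agree (C u) (C v))) * f := by
    intro k C f
    have h1 : ∀ c : Fin k, (∑ d : Fin k, (if d ≠ C u ∧ d ≠ c then f else 0)) =
          (k - 2 + agree (C u) c) * f := fun c => by
      rw [← sum_ite_ne_ne_one, Finset.sum_mul]
      simp only [ite_mul, one_mul, zero_mul]
    have h2 : ∀ c : Fin k, (if c ≠ C v then (k - 2 + agree (C u) c) * f else 0) =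
        f * (k - 2) * (if c ≠ C v then 1 else 0) +
          if C u = c then f * (1 - agree (C u) (C v)) else 0 := fun c => by
      by_cases h : c = C v
      · by_cases h' : C u = c <;> simp_all [agree]
      · by_cases h' : C u = c
        · subst h'
          simp [h, agree]
          ring
        · simp [h, h', agree]
          ring
    simp only [h1, h2, Finset.sum_add_distrib, ← Finset.mul_sum, sum_ite_ne_one]
    simp
    ring
  refine ⟨Option (Option V), inferInstance, addVertex (addVertex G {v}) {some u, none},
    some (some u), some (some v), x'', by simp, by simpa, hx'', fun k => ?_, fun k => ?_⟩ <;>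
    refine Eq.trans ?_ (coloringSum_addVertex _ k (fun C c => c ≠ C (some u) ∧ c ≠ C none)
      (by simp) _).symm <;>
    refine Eq.trans ?_ (coloringSum_addVertex G k (fun C c => c ≠ C v) (by simp) _).symm
  · rw [eval_mul, hA, ← coloringSum_mul]
    congr 1
    funext C
    refine Eq.trans ?_ (key k C (1 - agree (C u) (C v))).symm
    by_cases h : C u = C v <;> simp [h, agree]
    ring
  · rw [eval_mul, hB, ← coloringSum_mul]
    congr 1
    funext C
    refine Eq.trans ?_ (key k C (agree (C u) (C v))).symm
    by_cases h : C u = C v <;> simp [h, agree]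

/-! ### Ratios and the passage to spectrum values -/

/-- A state on `n` vertices has `s = (q - 1) B / A` at `q`, with `A` not vanishing. -/
def HasRatio (q : ℝ) (n : ℕ) (s : ℝ) : Prop :=
  ∃ A B : ℤ[X], HasState n A B ∧ aeval q A ≠ 0 ∧ (q - 1) * aeval q B = s * aeval q A

/-- At least `N` elements of `J` are ratios of states on `n` vertices. -/
def ManyRatios (q : ℝ) (J : Set ℝ) (n N : ℕ) : Prop :=
  ∃ T : Finset ℝ, N ≤ T.card ∧ ∀ s ∈ T, s ∈ J ∧ HasRatio q n s

theorem planarSpectrum_finite (n : ℕ) (q : ℝ) : (planarSpectrum n q).Finite :=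
  (Set.finite_range fun G : SimpleGraph (Fin n) => aeval q (chromaticPolynomial G)).subset
    fun _ ⟨G, _, h⟩ => ⟨G, h⟩

theorem planarSpectrum_ncard_pos {n : ℕ} (hn : 1 ≤ n) (q : ℝ) :
    1 ≤ (planarSpectrum n q).ncard := by
  refine (Set.ncard_pos (planarSpectrum_finite n q)).mpr ?_
  exact ⟨_, ⊥, (coneDrawable_bot (⟨0, hn⟩ : Fin n) (x := fun i => ((i : ℕ) : ℝ))
    fun a b h => Fin.ext (Nat.cast_injective h)).isPlanarGraph, rfl⟩

section Ratio

variable {q : ℝ} {n : ℕ} {s : ℝ}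

theorem hasRatio_two (h0 : q ≠ 0) (h1 : q ≠ 1) : HasRatio q 2 1 :=
  ⟨_, _, hasState_two, by simpa using ⟨h0, sub_ne_zero.mpr h1⟩, by simp; ring⟩

theorem HasRatio.isolated (h : HasRatio q n s) (h0 : q ≠ 0) : HasRatio q (n + 1) s := by
  obtain ⟨A, B, hAB, hA, hs⟩ := h
  refine ⟨_, _, hAB.isolated, by simpa using ⟨h0, hA⟩, ?_⟩
  simp only [map_mul, aeval_X]
  linear_combination q * hs

theorem HasRatio.series (h : HasRatio q n s) (hq : q - 2 + s ≠ 0) :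
    HasRatio q (n + 1) ((q - 1) / (q - 2 + s)) := by
  obtain ⟨A, B, hAB, hA, hs⟩ := h
  have hA' : aeval q ((X - 2) * A + (X - 1) * B) = (q - 2 + s) * aeval q A := by
    simp only [map_add, map_mul, map_sub, aeval_X, map_one, map_ofNat]
    linear_combination hs
  refine ⟨_, _, hAB.series, by rw [hA']; exact mul_ne_zero hq hA, ?_⟩
  rw [hA', ← mul_assoc, div_mul_cancel₀ _ hq]

theorem HasRatio.parallel (h : HasRatio q n s) (hq : q ≠ 2) :
    HasRatio q (n + 1) ((q - 1) / (q - 2) * s) := by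
  have hq' := sub_ne_zero.mpr hq
  obtain ⟨A, B, hAB, hA, hs⟩ := h
  refine ⟨_, _, hAB.parallel, ?_, ?_⟩ <;> simp only [map_mul, map_sub, aeval_X, map_one, map_ofNat]
  · exact mul_ne_zero hq' hA
  rw [hs]
  field_simp

theorem HasRatio.parallel_path (h : HasRatio q n s) :
    HasRatio q (n + 2) ((q - 1) * (q - 2) / (q ^ 2 - 3 * q + 3) * s) := by
  have hq : q ^ 2 - 3 * q + 3 ≠ 0 := by nlinarith [sq_nonneg (q - 3 / 2)]
  obtain ⟨A, B, hAB, hA, hs⟩ := h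
  refine ⟨_, _, hAB.parallel_path, ?_, ?_⟩ <;>
    simp only [map_mul, map_add, map_sub, map_pow, aeval_X, map_one, map_ofNat]
  · exact mul_ne_zero hq hA
  rw [div_mul_eq_mul_div, div_mul_eq_mul_div, eq_div_iff hq]
  linear_combination (q - 1) * (q - 2) * (q ^ 2 - 3 * q + 3) * hs

end Ratio

section Counting

variable {q : ℝ} {J : Set ℝ} {n N : ℕ}

/-- The pair (A, A + B) of spectrum values recovers s because A does not vanish, so the ratios
inject into the square of the spectrum. -/
theorem ManyRatios.le_ncard_sq (h : ManyRatios q J n N) : N ≤ (planarSpectrum n q).ncard ^ 2 := by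
  obtain ⟨T, hN, hT⟩ := h
  choose! A B hAB hA hs using fun s hs => (hT s hs).2
  refine hN.trans ?_
  rw [sq, ← Set.ncard_prod, ← Set.ncard_coe_finset T]
  refine Set.ncard_le_ncard_of_injOn
    (fun s => (aeval q (A s), aeval q (A s) + aeval q (B s)))
    (fun s h => ⟨(hAB s h).separated_mem q, (hAB s h).total_mem q⟩) ?_
    ((planarSpectrum_finite n q).prod (planarSpectrum_finite n q))
  intro s h t h' hst
  simp only [Prod.mk.injEq] at hst
  refine mul_right_cancel₀ (hA s h) ?_
  have hB : aeval q (B s) = aeval q (B t) := by linarith [hst.1, hst.2]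
  rw [← hs s h, hst.1, ← hs t h', hB]

theorem ManyRatios.sqrt_le (h : ManyRatios q J n N) : √(N : ℝ) ≤ (planarSpectrum n q).ncard :=
  Real.sqrt_le_iff.mpr ⟨Nat.cast_nonneg _, by exact_mod_cast h.le_ncard_sq⟩

theorem manyRatios_one {s : ℝ} (hs : s ∈ J) (h : HasRatio q n s) : ManyRatios q J n 1 :=
  ⟨{s}, by simp, by simpa using ⟨hs, h⟩⟩

/-- Two injective operations mapping `J` to disjoint subsets of `J` add up the counts. -/
theorem ManyRatios.add {m l M : ℕ} (h : ManyRatios q J n N) (h' : ManyRatios q J m M)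
    {f g : ℝ → ℝ} (hf : Set.InjOn f J) (hg : Set.InjOn g J)
    (hfg : ∀ s ∈ J, ∀ t ∈ J, f s ≠ g t)
    (hf' : ∀ s ∈ J, HasRatio q n s → f s ∈ J ∧ HasRatio q l (f s))
    (hg' : ∀ s ∈ J, HasRatio q m s → g s ∈ J ∧ HasRatio q l (g s)) :
    ManyRatios q J l (N + M) := by
  classical
  obtain ⟨T, hN, hT⟩ := h
  obtain ⟨U, hM, hU⟩ := h'
  refine ⟨T.image f ∪ U.image g, ?_, ?_⟩
  · rw [Finset.card_union_of_disjoint, Finset.card_image_of_injOn, Finset.card_image_of_injOn]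
    · exact Nat.add_le_add hN hM
    · exact hg.mono fun s hs => (hU s hs).1
    · exact hf.mono fun s hs => (hT s hs).1
    · rw [Finset.disjoint_left]
      intro x hx hx'
      obtain ⟨s, hs, rfl⟩ := Finset.mem_image.mp hx
      obtain ⟨t, ht, h⟩ := Finset.mem_image.mp hx'
      exact hfg s (hT s hs).1 t (hU t ht).1 h.symm
  · intro x hx
    rcases Finset.mem_union.mp hx with h | h
    · obtain ⟨s, hs, rfl⟩ := Finset.mem_image.mp h
      exact hf' s (hT s hs).1 (hT s hs).2
    · obtain ⟨s, hs, rfl⟩ := Finset.mem_image.mp h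
      exact hg' s (hU s hs).1 (hU s hs).2

end Counting

/-! ### Disjoint injective operations in the three ranges of q -/

theorem injOn_series {q : ℝ} (h1 : q ≠ 1) {J : Set ℝ} (hJ : ∀ s ∈ J, q - 2 + s ≠ 0) :
    Set.InjOn (fun s => (q - 1) / (q - 2 + s)) J := by
  intro s hs t ht h
  simp only at h
  rw [div_eq_div_iff (hJ s hs) (hJ t ht)] at h
  have := mul_left_cancel₀ (sub_ne_zero.mpr h1) h
  linarith

/-- With a = (q-1)/(q-2) in (0,1), the parallel step maps (0,1] into (0,a]. The series step is
increasing, fixes 1 and sends 0 to a, so it maps (0,1] into (a,1]. Each new vertex doubles the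
count. -/
theorem manyRatios_lt_one {q : ℝ} (h0 : q ≠ 0) (h1 : q < 1) (m : ℕ) :
    ManyRatios q (Set.Ioc 0 1) (m + 2) (2 ^ m) := by
  have ha : 0 < (q - 1) / (q - 2) := div_pos_of_neg_of_neg (by linarith) (by linarith)
  have ha' : (q - 1) / (q - 2) ≤ 1 := (div_le_one_of_neg (by linarith)).mpr (by linarith)
  have hJ : ∀ s ∈ Set.Ioc (0 : ℝ) 1, q - 2 + s < 0 := fun s hs => by linarith [hs.2]
  have hser : ∀ s ∈ Set.Ioc (0 : ℝ) 1, (q - 1) / (q - 2) < (q - 1) / (q - 2 + s) ∧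
      (q - 1) / (q - 2 + s) ≤ 1 := fun s hs => by
    have := hJ s hs
    refine ⟨?_, (div_le_one_of_neg this).mpr (by linarith [hs.2])⟩
    rw [← neg_div_neg_eq (q - 1) (q - 2), ← neg_div_neg_eq (q - 1) (q - 2 + s)]
    exact div_lt_div_of_pos_left (by linarith) (by linarith) (by linarith [hs.1])
  have hpar : ∀ s ∈ Set.Ioc (0 : ℝ) 1, 0 < (q - 1) / (q - 2) * s ∧
      (q - 1) / (q - 2) * s ≤ (q - 1) / (q - 2) := fun s hs =>
    ⟨mul_pos ha hs.1, mul_le_of_le_one_right ha.le hs.2⟩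
  induction m with
  | zero => exact manyRatios_one (by simp) (hasRatio_two h0 h1.ne)
  | succ m ih =>
    rw [pow_succ, mul_two]
    refine ih.add ih (injOn_series h1.ne fun s hs => (hJ s hs).ne)
      (g := fun s => (q - 1) / (q - 2) * s) (mul_right_injective₀ ha.ne').injOn ?_ ?_ ?_
    · exact fun s hs t ht => ((hpar t ht).2.trans_lt (hser s hs).1).ne'
    · exact fun s hs h => ⟨⟨ha.trans (hser s hs).1, (hser s hs).2⟩, h.series (hJ s hs).ne⟩
    · exact fun s hs h => ⟨⟨(hpar s hs).1, (hpar s hs).2.trans ha'⟩, h.parallel (by linarith)⟩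

/-- Now a > 1, and the parallel step maps [1,∞) into [a,∞). One series step reverses order and
leaves the interval, passing to (0,1]; a second one returns to [1,a). The costs of one and two
vertices give the Fibonacci recursion. -/
theorem manyRatios_two_lt {q : ℝ} (h2 : 2 < q) (m : ℕ) :
    ManyRatios q (Set.Ici 1) (m + 2) (Nat.fib (m + 1)) := by
  have h1 : q ≠ 1 := by linarith
  have ha : 1 < (q - 1) / (q - 2) := (one_lt_div (by linarith)).mpr (by linarith)
  have hpar : ∀ s ∈ Set.Ici (1 : ℝ), (q - 1) / (q - 2) ≤ (q - 1) / (q - 2) * s := fun s hs =>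
    le_mul_of_one_le_right (by linarith) hs
  have hser : ∀ s ∈ Set.Ici (1 : ℝ), 0 < q - 2 + s ∧ 0 < (q - 1) / (q - 2 + s) ∧
      (q - 1) / (q - 2 + s) ≤ 1 := fun s hs => by
    have hs' : 1 ≤ s := hs
    have : 0 < q - 2 + s := by linarith
    exact ⟨this, div_pos (by linarith) this, (div_le_one this).mpr (by linarith)⟩
  have hser' : ∀ t : ℝ, 0 < t → t ≤ 1 → 0 < q - 2 + t ∧ 1 ≤ (q - 1) / (q - 2 + t) ∧
      (q - 1) / (q - 2 + t) < (q - 1) / (q - 2) := fun t ht ht' => by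
    have : 0 < q - 2 + t := by linarith
    exact ⟨this, (one_le_div this).mpr (by linarith),
      div_lt_div_of_pos_left (by linarith) (by linarith) (by linarith)⟩
  have hser2 := fun s hs => hser' _ (hser s hs).2.1 (hser s hs).2.2
  have hpar' : ∀ {n s}, s ∈ Set.Ici (1 : ℝ) → HasRatio q n s →
      (q - 1) / (q - 2) * s ∈ Set.Ici (1 : ℝ) ∧ HasRatio q (n + 1) ((q - 1) / (q - 2) * s) :=
    fun hs h => ⟨ha.le.trans (hpar _ hs), h.parallel h2.ne'⟩
  have hone : ManyRatios q (Set.Ici 1) 2 1 :=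
    manyRatios_one (by simp) (hasRatio_two (by linarith) h1)
  induction m using Nat.twoStepInduction with
  | zero => exact hone
  | one =>
    have h := hpar' (Set.mem_Ici.mpr le_rfl) (hasRatio_two (by linarith) h1)
    exact manyRatios_one h.1 h.2
  | more m ih ih' =>
    rw [Nat.fib_add_two]
    refine ih.add ih' (f := fun s => (q - 1) / (q - 2 + (q - 1) / (q - 2 + s)))
      (g := fun s => (q - 1) / (q - 2) * s) ?_ (mul_right_injective₀ (by linarith)).injOn ?_ ?_ ?_
    · exact (injOn_series h1 (J := Set.Ioc 0 1) fun t ht => (hser' t ht.1 ht.2).1.ne').comp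
        (injOn_series h1 fun s hs => (hser s hs).1.ne') fun s hs => (hser s hs).2
    · exact fun s hs t ht => ((hser2 s hs).2.2.trans_le (hpar t ht)).ne
    · exact fun s hs h => ⟨(hser2 s hs).2.1, (h.series (hser s hs).1.ne').series (hser2 s hs).1.ne'⟩
    · exact fun s hs h => hpar' hs h

/-- The series map fixes 1 - q and sends 0 to a = (q-1)/(q-2) and a to c. Hence it maps [1-q,0) into
(a,1-q], and its square maps [1-q,0) into [1-q,c). The factor a may exceed 1 in modulus, so paths
with two interior vertices are used instead. Their factor c is negative with |c| < 1; applying it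
twice restores the sign and lands in (c,0). -/
theorem manyRatios_one_lt_two {q : ℝ} (h1 : 1 < q) (h2 : q < 2) (m : ℕ) :
    ManyRatios q (Set.Ico (1 - q) 0) (m + 4) (2 ^ (m / 4)) := by
  have hd : 0 < q ^ 2 - 3 * q + 3 := by nlinarith [sq_nonneg (q - 3 / 2)]
  set c := (q - 1) * (q - 2) / (q ^ 2 - 3 * q + 3) with hc
  have hc0 : c < 0 := div_neg_of_neg_of_pos (mul_neg_of_pos_of_neg (by linarith) (by linarith)) hd
  have hc1 : 1 - q ≤ c := by
    rw [hc, le_div_iff₀ hd]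
    nlinarith [mul_nonneg (sub_nonneg.mpr h1.le) (sq_nonneg (q - 1))]
  have hser : ∀ s ∈ Set.Ico (1 - q) 0, q - 2 + s < 0 ∧
      (q - 1) / (q - 2) < (q - 1) / (q - 2 + s) ∧ (q - 1) / (q - 2 + s) ≤ 1 - q := fun s hs => by
    have : q - 2 + s < 0 := by linarith [hs.2]
    refine ⟨this, ?_, ?_⟩
    · rw [← neg_div_neg_eq (q - 1) (q - 2), ← neg_div_neg_eq (q - 1) (q - 2 + s),
        div_lt_div_iff₀ (by linarith) (by linarith)]
      nlinarith [hs.2]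
    · rw [div_le_iff_of_neg this]
      nlinarith [hs.1]
  have hser' : ∀ t, (q - 1) / (q - 2) < t → t ≤ 1 - q → q - 2 + t < 0 ∧
      1 - q ≤ (q - 1) / (q - 2 + t) ∧ (q - 1) / (q - 2 + t) < c := fun t ht ht' => by
    have h : q - 2 + t < 0 := by linarith
    refine ⟨h, ?_, ?_⟩
    · rw [le_div_iff_of_neg h]
      nlinarith
    · rw [div_lt_iff_of_neg h, hc, div_mul_eq_mul_div, div_lt_iff₀ hd]
      rw [div_lt_iff_of_neg (by linarith)] at ht
      nlinarith
  have hser2 := fun s hs => hser' _ (hser s hs).2.1 (hser s hs).2.2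
  -- Both factors lie in [1-q,0), so the product is at most (q-1)² < 1.
  have hcc : c * (1 - q) < 1 := by nlinarith
  have hpath : ∀ s ∈ Set.Ico (1 - q) 0, c < c * (c * s) ∧ c * (c * s) < 0 := fun s hs => by
    have h3 : c * s ≤ c * (1 - q) := mul_le_mul_of_nonpos_left hs.1 hc0.le
    exact ⟨by nlinarith, mul_neg_of_neg_of_pos hc0 (mul_pos_of_neg_of_neg hc0 hs.2)⟩
  -- The initial ratio 1 is fixed by the series step and lies outside the interval; one path brings
  -- it to c.
  have hone : HasRatio q 4 c := by
    simpa using (hasRatio_two (by linarith) h1.ne').parallel_path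
  have hiso : ∀ {n s}, HasRatio q n s → HasRatio q (n + 1) s := fun h => h.isolated (by linarith)
  have hsmall : ∀ r, r < 4 → ManyRatios q (Set.Ico (1 - q) 0) (r + 4) 1 := fun r hr => by
    refine manyRatios_one (s := c) ⟨hc1, hc0⟩ ?_
    clear hr
    induction r with
    | zero => exact hone
    | succ r ih => exact Nat.add_right_comm r 4 1 ▸ hiso ih
  induction m using Nat.strong_induction_on with
  | _ m ih =>
    rcases lt_or_ge m 4 with h | h
    · rw [Nat.div_eq_of_lt h, pow_zero]
      exact hsmall m h
    · obtain ⟨m, rfl⟩ := Nat.exists_eq_add_of_le' h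
      rw [Nat.add_div_right _ (by norm_num), pow_succ, mul_two]
      have ih := ih m (by omega)
      refine ih.add ih (f := fun s => (q - 1) / (q - 2 + (q - 1) / (q - 2 + s)))
        (g := fun s => c * (c * s)) ?_ ?_ ?_ ?_ ?_
      · exact (injOn_series h1.ne' (J := Set.Ioc ((q - 1) / (q - 2)) (1 - q))
          fun t ht => (hser' t ht.1 ht.2).1.ne).comp
          (injOn_series h1.ne' fun s hs => (hser s hs).1.ne) fun s hs => (hser s hs).2
      · exact ((mul_right_injective₀ hc0.ne).comp (mul_right_injective₀ hc0.ne)).injOn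
      · exact fun s hs t ht => ((hser2 s hs).2.2.trans (hpath t ht).1).ne
      -- Two isolated vertices pad the double series step, so that both operations cost four
      -- vertices.
      · exact fun s hs h => ⟨⟨(hser2 s hs).2.1, (hser2 s hs).2.2.trans hc0⟩,
          hiso (hiso ((h.series (hser s hs).1.ne).series (hser2 s hs).1.ne))⟩
      · exact fun s hs h => ⟨⟨hc1.trans (hpath s hs).1.le, (hpath s hs).2⟩,
          h.parallel_path.parallel_path⟩

/-! ### From counts of ratios to the stated bounds -/

theorem two_rpow_half_le_sqrt {r : ℝ} {m : ℕ} (h : r ≤ m) :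
    (2 : ℝ) ^ (r / 2) ≤ √((2 ^ m : ℕ) : ℝ) := by
  rw [Real.sqrt_eq_rpow, Nat.cast_pow, Nat.cast_ofNat, ← Real.rpow_natCast,
    ← Real.rpow_mul (by norm_num)]
  exact Real.rpow_le_rpow_of_exponent_le (by norm_num) (by linarith)

theorem two_rpow_le_ncard_of_nonpos {n : ℕ} (hn : 1 ≤ n) (q : ℝ) {r : ℝ} (hr : r ≤ 0) :
    (2 : ℝ) ^ r ≤ (planarSpectrum n q).ncard :=
  (Real.rpow_le_one_of_one_le_of_nonpos (by norm_num) hr).trans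
    (by exact_mod_cast planarSpectrum_ncard_pos hn q)

theorem ncard_planarSpectrum_lt_one {q : ℝ} (h0 : q ≠ 0) (h1 : q < 1) {n : ℕ} (hn : 1 ≤ n) :
    (2 : ℝ) ^ (((n : ℝ) - 2) / 2) ≤ (planarSpectrum n q).ncard := by
  rcases lt_or_ge n 2 with h | h
  · have : (n : ℝ) ≤ 2 := by exact_mod_cast h.le
    exact two_rpow_le_ncard_of_nonpos hn q (by linarith)
  · obtain ⟨m, rfl⟩ := Nat.exists_eq_add_of_le' h
    exact (two_rpow_half_le_sqrt (by push_cast; linarith)).trans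
      (manyRatios_lt_one h0 h1 m).sqrt_le

theorem ncard_planarSpectrum_one_lt_two {q : ℝ} (h1 : 1 < q) (h2 : q < 2) {n : ℕ} (hn : 1 ≤ n) :
    (2 : ℝ) ^ ((n : ℝ) / 8 - 7 / 8) ≤ (planarSpectrum n q).ncard := by
  rcases lt_or_ge n 4 with h | h
  · have : (n : ℝ) ≤ 4 := by exact_mod_cast h.le
    exact two_rpow_le_ncard_of_nonpos hn q (by linarith)
  · obtain ⟨m, rfl⟩ := Nat.exists_eq_add_of_le' h
    -- The floor loses at most 3, so the exponent is at least (n - 4 - 3)/4, halved by the square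
    -- root; this is the source of 7/8.
    have hm : ((m : ℕ) : ℝ) ≤ 4 * (m / 4 : ℕ) + 3 := by
      exact_mod_cast show m ≤ 4 * (m / 4) + 3 by omega
    rw [show ((m + 4 : ℕ) : ℝ) / 8 - 7 / 8 = (((m : ℝ) - 3) / 4) / 2 by push_cast; ring]
    exact (two_rpow_half_le_sqrt (by linarith)).trans (manyRatios_one_lt_two h1 h2 m).sqrt_le

theorem ncard_planarSpectrum_lt_two {q : ℝ} (h0 : q ≠ 0) (h1 : q ≠ 1) (h2 : q < 2) {n : ℕ}
    (hn : 1 ≤ n) : (2 : ℝ) ^ ((n : ℝ) / 8 - 7 / 8) ≤ (planarSpectrum n q).ncard := by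
  rcases lt_or_gt_of_ne h1 with h | h
  · rcases lt_or_ge n 2 with hn2 | hn2
    · have : (n : ℝ) ≤ 2 := by exact_mod_cast hn2.le
      exact two_rpow_le_ncard_of_nonpos hn q (by linarith)
    · have : (2 : ℝ) ≤ n := by exact_mod_cast hn2
      exact (Real.rpow_le_rpow_of_exponent_le (by norm_num) (by linarith)).trans
        (ncard_planarSpectrum_lt_one h0 h hn)
  · exact ncard_planarSpectrum_one_lt_two h h2 hn

theorem ncard_planarSpectrum_two_lt {q : ℝ} (h2 : 2 < q) {n : ℕ} (hn : 2 ≤ n) :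
    √(Nat.fib (n - 2) : ℝ) ≤ (planarSpectrum n q).ncard := by
  obtain ⟨m, rfl⟩ := Nat.exists_eq_add_of_le' hn
  -- The ratios number at least F_{n-1}, which is weakened here to F_{n-2}.
  refine le_trans (Real.sqrt_le_sqrt ?_) (manyRatios_two_lt h2 m).sqrt_le
  exact_mod_cast Nat.fib_le_fib_succ

theorem fib_succ_le_goldenRatio_pow (n : ℕ) : (Nat.fib (n + 1) : ℝ) ≤ Real.goldenRatio ^ n := by
  have h := Real.goldenRatio_mul_fib_succ_add_fib n
  rw [pow_succ'] at h
  have h0 : (0 : ℝ) ≤ Nat.fib n := Nat.cast_nonneg _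
  exact le_of_mul_le_mul_left (by linarith) Real.goldenRatio_pos

/-- In φ^(n+1) = φ F_{n+1} + F_n, replace F_n by F_{n+1} and use φ + 1 = φ². -/
theorem goldenRatio_pow_le_fib_succ (n : ℕ) :
    Real.goldenRatio ^ (n + 1) ≤ Real.goldenRatio ^ 2 * Nat.fib (n + 1) := by
  have h := Real.goldenRatio_mul_fib_succ_add_fib n
  have h0 : (Nat.fib n : ℝ) ≤ Nat.fib (n + 1) := by exact_mod_cast Nat.fib_le_fib_succ
  rw [Real.goldenRatio_sq]
  linarith

theorem sqrt_goldenRatio_pow (k : ℕ) :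
    Real.goldenRatio ^ ((k : ℝ) / 2) = √(Real.goldenRatio ^ k) := by
  rw [Real.sqrt_eq_rpow, ← Real.rpow_natCast, ← Real.rpow_mul Real.goldenRatio_pos.le]
  ring_nf

theorem goldenRatio_rpow_le_sqrt_fib {n : ℕ} (hn : 3 ≤ n) :
    Real.goldenRatio ^ (((n : ℝ) - 2) / 2) ≤ Real.goldenRatio * √(Nat.fib (n - 2) : ℝ) := by
  obtain ⟨m, rfl⟩ := Nat.exists_eq_add_of_le' hn
  have : ((m + 3 : ℕ) : ℝ) - 2 = ((m + 1 : ℕ) : ℝ) := by push_cast; ring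
  rw [this, sqrt_goldenRatio_pow, show m + 3 - 2 = m + 1 by omega]
  refine (Real.sqrt_le_sqrt (goldenRatio_pow_le_fib_succ m)).trans_eq ?_
  rw [Real.sqrt_mul (by positivity), Real.sqrt_sq Real.goldenRatio_pos.le]

theorem sqrt_fib_isTheta : (fun n : ℕ => √(Nat.fib (n - 2) : ℝ)) =Θ[atTop]
    (fun n : ℕ => Real.goldenRatio ^ (((n : ℝ) - 2) / 2)) := by
  constructor
  · refine IsBigO.of_bound 1 ((eventually_ge_atTop 3).mono fun n hn => ?_)
    obtain ⟨m, rfl⟩ := Nat.exists_eq_add_of_le' hn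
    have : ((m + 3 : ℕ) : ℝ) - 2 = ((m + 1 : ℕ) : ℝ) := by push_cast; ring
    rw [this, sqrt_goldenRatio_pow, show m + 3 - 2 = m + 1 by omega, one_mul,
      Real.norm_of_nonneg (Real.sqrt_nonneg _), Real.norm_of_nonneg (Real.sqrt_nonneg _)]
    exact Real.sqrt_le_sqrt ((fib_succ_le_goldenRatio_pow m).trans
      (pow_le_pow_right₀ Real.one_lt_goldenRatio.le (Nat.le_succ m)))
  · refine IsBigO.of_bound Real.goldenRatio ((eventually_ge_atTop 3).mono fun n hn => ?_)
    rw [Real.norm_of_nonneg (Real.sqrt_nonneg _),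
      Real.norm_of_nonneg (Real.rpow_nonneg Real.goldenRatio_pos.le _)]
    exact goldenRatio_rpow_le_sqrt_fib hn

theorem exists_exponential_lower_bound {q : ℝ} (h0 : q ≠ 0) (h1 : q ≠ 1) (h2 : q ≠ 2) :
    ∃ c : ℝ, 1 < c ∧ ∀ᶠ n : ℕ in atTop, c ^ n ≤ ((planarSpectrum n q).ncard : ℝ) := by
  rcases lt_or_gt_of_ne h2 with h | h
  -- Half of the rate 1/8: n/16 ≤ n/8 - 7/8 holds exactly when n ≥ 14.
  · refine ⟨2 ^ (1 / 16 : ℝ), Real.one_lt_rpow (by norm_num) (by norm_num),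
      (eventually_ge_atTop 14).mono fun n hn => ?_⟩
    have hn' : (14 : ℝ) ≤ n := by exact_mod_cast hn
    rw [← Real.rpow_natCast, ← Real.rpow_mul (by norm_num)]
    exact (Real.rpow_le_rpow_of_exponent_le (by norm_num) (by linarith)).trans
      (ncard_planarSpectrum_lt_two h0 h1 h (by omega))
  · have hφ := Real.one_lt_goldenRatio
    -- Half of the rate 1/2; absorbing the extra factor φ requires 1 + n/4 ≤ (n-2)/2, that is n ≥ 8.
    refine ⟨Real.goldenRatio ^ (1 / 4 : ℝ), Real.one_lt_rpow hφ (by norm_num),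
      (eventually_ge_atTop 8).mono fun n hn => ?_⟩
    have hn' : (8 : ℝ) ≤ n := by exact_mod_cast hn
    rw [← Real.rpow_natCast, ← Real.rpow_mul Real.goldenRatio_pos.le]
    refine le_trans ?_ (ncard_planarSpectrum_two_lt h (by omega))
    refine le_of_mul_le_mul_left ?_ Real.goldenRatio_pos
    refine le_trans ?_ (goldenRatio_rpow_le_sqrt_fib (by omega))
    rw [← Real.rpow_one_add' Real.goldenRatio_pos.le (by positivity)]
    exact Real.rpow_le_rpow_of_exponent_le hφ.le (by linarith)

theorem theorem1p1 :
    (∀ q : ℝ, q ≠ 0 → q ≠ 1 → q ≠ 2 →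
      ∃ c : ℝ, 1 < c ∧ ∀ᶠ n : ℕ in atTop, c ^ n ≤ ((planarSpectrum n q).ncard : ℝ)) ∧
    (∀ q : ℝ, q < 0 → ∀ n : ℕ, 1 ≤ n →
      (2 : ℝ) ^ (((n : ℝ) - 2) / 2) ≤ ((planarSpectrum n q).ncard : ℝ)) ∧
    (∃ ε : ℕ → ℝ, ε =o[atTop] (fun n : ℕ => (n : ℝ)) ∧
      ∀ q : ℝ, 0 < q → q < 2 → q ≠ 1 → ∀ n : ℕ, 1 ≤ n →
        (2 : ℝ) ^ ((n : ℝ) / 8 - ε n) ≤ ((planarSpectrum n q).ncard : ℝ)) ∧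
    (∀ q : ℝ, 2 < q → ∀ n : ℕ, 2 ≤ n →
      √(Nat.fib (n - 2) : ℝ) ≤ ((planarSpectrum n q).ncard : ℝ)) ∧
    (fun n : ℕ => √(Nat.fib (n - 2) : ℝ)) =Θ[atTop]
      (fun n : ℕ => Real.goldenRatio ^ (((n : ℝ) - 2) / 2)) := by
  refine ⟨fun q h0 h1 h2 => exists_exponential_lower_bound h0 h1 h2,
    fun q hq n hn => ncard_planarSpectrum_lt_one hq.ne (by linarith) hn,
    ⟨fun _ => 7 / 8, ?_, fun q h0 h2 h1 n hn => ncard_planarSpectrum_lt_two h0.ne' h1 h2 hn⟩,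
    fun q hq n hn => ncard_planarSpectrum_two_lt hq hn, sqrt_fib_isTheta⟩
  exact isLittleO_const_left.mpr (Or.inr
    (tendsto_norm_atTop_atTop.comp tendsto_natCast_atTop_atTop))
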